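/- Let $g\ge 1$ be a fixed integer. For $n\ge 3$ consider a file of $N=ng$ information packets over a finite field $GF(q)$ that is partitioned into $n$ disjoint generations of size $g$. Coded packets are generated independently: for each of them one of the $n$ generations is selected uniformly at random (each with probability $1/n$), and then a coding vector is selected uniformly at random from $GF(q)^g$; the coded packet is the corresponding linear combination of the $g$ packets of the selected generation, and the receiver also learns the generation index and the coding vector. A generation can be decoded once the coding vectors collected for it contain $g$ linearly independent ones, and decoding fails if some information packet is not decoded. Then, as $n\to\infty$, the probability $P_n(t)$ of decoding failure when $t$ coded packets have been collected satisfies $$P_n(t) > 1-\exp\left[-\frac{1}{(g-1)!}\,n(\log n)^{g-1}e^{-t/n}\right]+\mathcal{O}\left(\frac{\log\log n}{\log n}\right),$$ where the error term is uniform in $t$ and $q$. That is, there is a constant $C>0$ depending only on $g$ such that, for all finite fields $GF(q)$, all $n\ge 3$ and all integers $t\ge 0$, $$P_n(t) > 1-\exp\left[-\frac{1}{(g-1)!}\,n(\log n)^{g-1}e^{-t/n}\right]-C\,\frac{\log\log n}{\log n}.$$ -/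

import Mathlib

open MeasureTheory

noncomputable section

/-- The file consists of `N` information packets, indexed by `Fin N`; the generations are subsets
`G 0, …, G (n - 1)` of it. For the purpose of decoding, a coded packet is the index `j` of a
generation together with a coding vector, which has one coefficient in the finite field `F`
for each information packet of `G j`. -/
abbrev CodedPacket (F : Type*) {n N : ℕ} (G : Fin n → Finset (Fin N)) : Type _ :=
  Σ j : Fin n, (G j → F)

/-- Coded packets form a finite set; every set of coded packets is an event. -/
instance CodedPacket.instMeasurableSpace (F : Type*) {n N : ℕ} (G : Fin n → Finset (Fin N)) :
    MeasurableSpace (CodedPacket F G) := ⊤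

/-- The law of one transmitted coded packet: the generation `j` is scheduled with probability
`ρ j`; then the coding vector is uniform on all vectors over `F` indexed by `G j`
(equivalently, its components are independent and uniform on `F`). -/
def packetLaw (F : Type*) [Field F] [Fintype F] {n N : ℕ} (G : Fin n → Finset (Fin N))
    (ρ : PMF (Fin n)) : PMF (CodedPacket F G) :=
  ρ.bind fun j => (PMF.uniformOfFintype (G j → F)).map fun e => ⟨j, e⟩

/-- The law of `t` collected coded packets, which are independent. -/
def collectedLaw (F : Type*) [Field F] [Fintype F] {n N : ℕ} (G : Fin n → Finset (Fin N))
    (ρ : PMF (Fin n)) (t : ℕ) : Measure (Fin t → CodedPacket F G) :=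
  Measure.pi fun _ => (packetLaw F G ρ).toMeasure

/-- The coefficient vectors of the linear equations collected for generation `j`, after the
information packets in `S`, which are already known, have been removed as unknowns
(their coefficients are set to `0`). -/
def residualVectors {F : Type*} [Field F] {n N t : ℕ} {G : Fin n → Finset (Fin N)}
    (y : Fin t → CodedPacket F G) (S : Finset (Fin N)) (j : Fin n) : Set (G j → F) :=
  {v | ∃ (k : Fin t) (e : G j → F), y k = ⟨j, e⟩ ∧
    v = fun i : G j => if (i : Fin N) ∈ S then 0 else e i}

/-- With the information packets in `S` known, generation `j` is decodable if the number of
linearly independent equations collected for it equals the number of its unknown packets. -/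
def GenerationDecodable {F : Type*} [Field F] {n N t : ℕ} {G : Fin n → Finset (Fin N)}
    (y : Fin t → CodedPacket F G) (S : Finset (Fin N)) (j : Fin n) : Prop :=
  Module.finrank F (Submodule.span F (residualVectors y S j)) = (G j \ S).card

/-- The information packets that the receiver decodes from the collected coded packets `y`:
whenever, relative to a set `S` of packets already decoded (initially `∅`), a generation is
decodable, all of its packets become decoded. -/
inductive PacketDecoded {F : Type*} [Field F] {n N t : ℕ} {G : Fin n → Finset (Fin N)}
    (y : Fin t → CodedPacket F G) : Fin N → Prop
  | step (S : Finset (Fin N)) (hS : ∀ i ∈ S, PacketDecoded y i) (j : Fin n)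
      (hj : GenerationDecodable y S j) (i : Fin N) (hi : i ∈ G j) : PacketDecoded y i

/-- Decoding fails if some information packet is not decoded. -/
def DecodingFailure {F : Type*} [Field F] {n N t : ℕ} {G : Fin n → Finset (Fin N)}
    (y : Fin t → CodedPacket F G) : Prop :=
  ∃ i : Fin N, ¬ PacketDecoded y i

/-- The probability of decoding failure when `t` coded packets have been collected. -/
def failureProb (F : Type*) [Field F] [Fintype F] {n N : ℕ} (G : Fin n → Finset (Fin N))
    (ρ : PMF (Fin n)) (t : ℕ) : ℝ :=
  (collectedLaw F G ρ t).real {y | DecodingFailure y}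

end

/-!
A generation for which fewer than `g` packets were collected cannot be decoded
(`not_packetDecoded_of_card_lt`), whatever the field. So decoding fails whenever, after throwing
`t` balls uniformly into `n` urns, some urn holds fewer than `g` balls. The urn counts are
negatively dependent (`card_occupancy_le`), hence the probability that every urn holds at least `g`
balls is at most `(1 - p) ^ n ≤ exp (-n p)`, where `p` is the probability that a binomial variable
with `t` trials and success probability `1 / n` is smaller than `g` (`one_sub_exp_le_failureProb`).

It remains to compare `n p` with `x = n (log n) ^ (g - 1) exp (-t / n) / (g - 1)!`, with an error
of order `ε = log (log n) / log n`, uniformly in `t`. There are three ranges.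
* If `t / n ≤ log n - log (log n)`, the empty urns alone give `n p ≥ log n / e`, so that
  `exp (-n p) = O(1 / log n)`.
* If `t / n ≥ 2 log n`, then `x = O(1 / log n)`, and `exp (-x) ≥ 1 - x` suffices.
* In between, the point mass at `g - 1` gives `n p ≥ x (1 - O(ε))`, and `x ↦ exp (-x)` turns the
  relative error in the exponent into an absolute error `O(ε)`, uniformly in `x`.

For `n ≥ 3` the quantity `log (log n)` is at least `log (log 3) > 0`, so `1 / log n = O(ε)`; and
when `ε` is not small the claim is trivial for a large constant. No lower bound on `n` beyond `3`
is therefore needed.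
-/

/-! ### Lower tail of the binomial law -/

/-- The probability that a binomial variable with `t` trials and success probability `u` is
smaller than `a`, defined by conditioning on one trial (for `a = 0` the truncated `a - 1` is
harmless, both values being `0`). -/
def binomialLT (u : ℝ) : ℕ → ℕ → ℝ
  | 0, a => if a = 0 then 0 else 1
  | t + 1, a => (1 - u) * binomialLT u t a + u * binomialLT u t (a - 1)

lemma binomialLT_mono {u : ℝ} (h0 : 0 ≤ u) (h1 : u ≤ 1) (t : ℕ) :
    Monotone (binomialLT u t) := by
  induction t with
  | zero =>
    intro a b hab
    simp only [binomialLT]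
    split_ifs <;> first | omega | norm_num
  | succ t ih =>
    intro a b hab
    simp only [binomialLT]
    exact add_le_add (mul_le_mul_of_nonneg_left (ih hab) (by linarith))
      (mul_le_mul_of_nonneg_left (ih (by omega)) h0)

lemma binomialLT_zero_right (u : ℝ) (t : ℕ) : binomialLT u t 0 = 0 := by
  induction t with
  | zero => simp [binomialLT]
  | succ t ih => simp [binomialLT, ih]

lemma binomialLT_nonneg {u : ℝ} (h0 : 0 ≤ u) (h1 : u ≤ 1) (t a : ℕ) : 0 ≤ binomialLT u t a :=
  (binomialLT_zero_right u t).symm.le.trans (binomialLT_mono h0 h1 t (Nat.zero_le a))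

lemma binomialLT_le_one {u : ℝ} (h0 : 0 ≤ u) (h1 : u ≤ 1) (t a : ℕ) : binomialLT u t a ≤ 1 := by
  induction t generalizing a with
  | zero =>
    simp only [binomialLT]
    split_ifs <;> norm_num
  | succ t ih =>
    simp only [binomialLT]
    nlinarith [mul_le_mul_of_nonneg_left (ih a) (sub_nonneg.2 h1),
      mul_le_mul_of_nonneg_left (ih (a - 1)) h0]

lemma pow_le_binomialLT {u : ℝ} (h0 : 0 ≤ u) (h1 : u ≤ 1) (t m : ℕ) :
    (1 - u) ^ t ≤ binomialLT u t (m + 1) := by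
  induction t with
  | zero => simp [binomialLT]
  | succ t ih =>
    have h := mul_le_mul_of_nonneg_left ih (sub_nonneg.2 h1)
    have h' := mul_nonneg h0 (binomialLT_nonneg h0 h1 t m)
    simp only [binomialLT, Nat.add_sub_cancel, pow_succ']
    linarith

/-- The lower tail is bounded below by its point mass at `m` (with `(1 - u) ^ t` in place of
`(1 - u) ^ (t - m)`). -/
lemma choose_mul_pow_le_binomialLT {u : ℝ} (h0 : 0 ≤ u) (h1 : u ≤ 1) (t m : ℕ) :
    t.choose m * u ^ m * (1 - u) ^ t ≤ binomialLT u t (m + 1) := by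
  induction t generalizing m with
  | zero => cases m <;> simp [binomialLT]
  | succ t ih =>
    cases m with
    | zero => simpa using pow_le_binomialLT h0 h1 (t + 1) 0
    | succ m =>
      have hu := sub_nonneg.2 h1
      have hA := mul_le_mul_of_nonneg_left (ih (m + 1)) hu
      have hB := mul_le_mul_of_nonneg_left (ih m) h0
      have hC : 0 ≤ u * (t.choose m * u ^ m * (1 - u) ^ t) * u := by positivity
      simp only [binomialLT, Nat.add_sub_cancel, Nat.choose_succ_succ, Nat.cast_add]
      calc ((t.choose m : ℝ) + t.choose (m + 1)) * u ^ (m + 1) * (1 - u) ^ (t + 1)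
          = (1 - u) * (t.choose (m + 1) * u ^ (m + 1) * (1 - u) ^ t)
            + u * (t.choose m * u ^ m * (1 - u) ^ t)
            - u * (t.choose m * u ^ m * (1 - u) ^ t) * u := by ring
        _ ≤ _ := by linarith

/-! ### Negative dependence of urn counts -/

/-- The terms of degree at most one in the `d j` bound the expanded product from below. -/
lemma prod_add_sum_mul_prod_erase_le {ι : Type*} [DecidableEq ι] (s : Finset ι) (b d : ι → ℝ)
    (hb : ∀ j, 0 ≤ b j) (hd : ∀ j, 0 ≤ d j) :
    ∏ j ∈ s, b j + ∑ i ∈ s, d i * ∏ j ∈ s.erase i, b j ≤ ∏ j ∈ s, (b j + d j) := by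
  induction s using Finset.induction_on with
  | empty => simp
  | insert a s ha ih =>
    rw [Finset.prod_insert ha, Finset.sum_insert ha, Finset.prod_insert ha,
      Finset.erase_insert ha]
    have hsum : ∑ i ∈ s, d i * ∏ j ∈ (insert a s).erase i, b j
        = b a * ∑ i ∈ s, d i * ∏ j ∈ s.erase i, b j := by
      rw [Finset.mul_sum]
      refine Finset.sum_congr rfl fun i hi => ?_
      have hne : a ≠ i := fun h => ha (h ▸ hi)
      rw [Finset.erase_insert_of_ne hne, Finset.prod_insert (by simp [ha])]
      ring
    rw [hsum]
    have hS : 0 ≤ ∑ i ∈ s, d i * ∏ j ∈ s.erase i, b j :=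
      Finset.sum_nonneg fun i _ => mul_nonneg (hd i) (Finset.prod_nonneg fun j _ => hb j)
    have h1 := mul_le_mul_of_nonneg_left ih (hb a)
    have h2 := mul_le_mul_of_nonneg_left ih (hd a)
    nlinarith [mul_nonneg (hd a) hS]

lemma card_filter_cons_eq {n t : ℕ} (j i : Fin n) (w : Fin t → Fin n) :
    (Finset.univ.filter fun k => (Fin.cons i w : Fin (t + 1) → Fin n) k = j).card
      = (if i = j then 1 else 0) + (Finset.univ.filter fun k => w k = j).card := by
  simp only [Finset.card_filter, Fin.sum_univ_succ, Fin.cons_zero, Fin.cons_succ]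

/-- Conditioning on the urn `i` of the first ball. -/
lemma card_occupancy_succ {n : ℕ} (t : ℕ) (a : Fin n → ℕ) :
    (Finset.univ.filter fun w : Fin (t + 1) → Fin n =>
      ∀ j, a j ≤ (Finset.univ.filter fun k => w k = j).card).card
    = ∑ i : Fin n, (Finset.univ.filter fun w : Fin t → Fin n =>
      ∀ j, a j - (if i = j then 1 else 0) ≤ (Finset.univ.filter fun k => w k = j).card).card := by
  rw [Finset.card_filter, ← (Fin.consEquiv fun _ : Fin (t + 1) => Fin n).sum_comp,
    Fintype.sum_prod_type]
  refine Finset.sum_congr rfl fun i _ => ?_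
  rw [Finset.card_filter]
  refine Finset.sum_congr rfl fun w _ => ?_
  refine if_congr (forall_congr' fun j => ?_) rfl rfl
  rw [tsub_le_iff_left, ← card_filter_cons_eq j i w]
  rfl

/-- When `t` balls are thrown uniformly into `n` urns, the events that urn `j` receives at least
`a j` balls are negatively dependent: the probability of their intersection is at most the
product of their probabilities. By induction on `t`: the conditional bounds average to the part of
degree at most one of the product for `t + 1` balls, expanded in the increments of its factors. -/
lemma card_occupancy_le {n : ℕ} (hn : 0 < n) (t : ℕ) (a : Fin n → ℕ) :
    ((Finset.univ.filter fun w : Fin t → Fin n =>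
      ∀ j, a j ≤ (Finset.univ.filter fun k => w k = j).card).card : ℝ)
    ≤ n ^ t * ∏ j, (1 - binomialLT (1 / n) t (a j)) := by
  have hn' : (0 : ℝ) < n := by exact_mod_cast hn
  have h0 : (0 : ℝ) ≤ 1 / n := by positivity
  have h1 : (1 : ℝ) / n ≤ 1 := by
    rw [div_le_one hn']
    exact_mod_cast hn
  induction t generalizing a with
  | zero =>
    by_cases h : ∀ j, a j = 0
    · simp [h, binomialLT]
    · have : ¬ ∀ j, a j ≤ 0 := by simpa using h
      simp only [Finset.univ_eq_empty, Finset.filter_empty, Finset.card_empty, this,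
        Finset.filter_false, Nat.cast_zero]
      refine mul_nonneg (by positivity) (Finset.prod_nonneg fun j _ => ?_)
      linarith [binomialLT_le_one h0 h1 0 (a j)]
  | succ t ih =>
    rw [card_occupancy_succ, Nat.cast_sum]
    refine (Finset.sum_le_sum fun i _ => ih _).trans ?_
    -- `b j` is the probability for `t` balls, and `d j` its increase from one more ball.
    set b : Fin n → ℝ := fun j => 1 - binomialLT (1 / n) t (a j) with hb
    set d : Fin n → ℝ := fun j =>
      (1 / n) * (binomialLT (1 / n) t (a j) - binomialLT (1 / n) t (a j - 1)) with hd
    have hb0 : ∀ j, 0 ≤ b j := fun j => by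
      linarith [binomialLT_le_one h0 h1 t (a j)]
    have hd0 : ∀ j, 0 ≤ d j := fun j =>
      mul_nonneg h0 (sub_nonneg.2 (binomialLT_mono h0 h1 t (Nat.sub_le _ _)))
    have hstep : ∀ i, ∏ j, (1 - binomialLT (1 / n) t (a j - (if i = j then 1 else 0)))
        = ∏ j, b j + n * (d i * ∏ j ∈ Finset.univ.erase i, b j) := by
      intro i
      rw [← Finset.mul_prod_erase Finset.univ b (Finset.mem_univ i),
        ← Finset.mul_prod_erase Finset.univ _ (Finset.mem_univ i)]
      have : ∏ j ∈ Finset.univ.erase i,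
          (1 - binomialLT (1 / n) t (a j - (if i = j then 1 else 0)))
          = ∏ j ∈ Finset.univ.erase i, b j := by
        refine Finset.prod_congr rfl fun j hj => ?_
        rw [if_neg (Finset.ne_of_mem_erase hj).symm, Nat.sub_zero]
      rw [this, if_pos rfl]
      simp only [hb, hd]
      field_simp
      ring
    have hsucc : ∀ j, 1 - binomialLT (1 / n) (t + 1) (a j) = b j + d j := fun j => by
      simp only [binomialLT, hb, hd]
      ring
    simp only [hstep, hsucc]
    rw [← Finset.mul_sum, Finset.sum_add_distrib, ← Finset.mul_sum, Finset.sum_const,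
      Finset.card_univ, Fintype.card_fin, nsmul_eq_mul, ← mul_add, pow_succ, mul_assoc]
    gcongr
    exact prod_add_sum_mul_prod_erase_le Finset.univ b d hb0 hd0

/-! ### From decoding to occupancy -/

lemma measure_fst_eq {F : Type*} [Field F] [Fintype F] {n N : ℕ} (G : Fin n → Finset (Fin N))
    (ρ : PMF (Fin n)) (j : Fin n) :
    (packetLaw F G ρ).toMeasure {c | c.1 = j} = ρ j := by
  have hmap : (packetLaw F G ρ).map Sigma.fst = ρ := by
    simp only [packetLaw, PMF.map_bind, PMF.map_comp]
    conv_rhs => rw [← ρ.bind_pure]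
    congr 1
    funext i
    exact PMF.map_const _ i
  have hmeas : Measurable (Sigma.fst : CodedPacket F G → Fin n) := fun _ _ => trivial
  conv_rhs => rw [← hmap]
  rw [← PMF.toMeasure_apply_singleton _ j (measurableSet_singleton j),
    PMF.toMeasure_map_apply _ _ _ hmeas (measurableSet_singleton j)]
  rfl

/-- The generation indices of the collected packets form a uniform word in `Fin t → Fin n`, so the
bound on occupancy counts is a bound on probabilities. -/
lemma collectedLaw_real_occupancy_le {F : Type*} [Field F] [Fintype F] {n N : ℕ}
    (G : Fin n → Finset (Fin N)) (ρ : PMF (Fin n)) (hn : 0 < n)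
    (hρ : ∀ j, ρ j = (n : ENNReal)⁻¹) (t g : ℕ) :
    (collectedLaw F G ρ t).real
      {y | ∀ j, g ≤ (Finset.univ.filter fun k => (y k).1 = j).card}
    ≤ (1 - binomialLT (1 / n) t g) ^ n := by
  set W := Finset.univ.filter fun w : Fin t → Fin n =>
      ∀ j, g ≤ (Finset.univ.filter fun k => w k = j).card with hW
  have hn' : (0 : ℝ) < n := by exact_mod_cast hn
  have hle : (collectedLaw F G ρ t)
      {y | ∀ j, g ≤ (Finset.univ.filter fun k => (y k).1 = j).card}
      ≤ W.card * ((n : ENNReal)⁻¹) ^ t := by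
    have hsub : {y : Fin t → CodedPacket F G |
          ∀ j, g ≤ (Finset.univ.filter fun k => (y k).1 = j).card}
        ⊆ ⋃ w ∈ W, Set.pi Set.univ fun k => {c : CodedPacket F G | c.1 = w k} := by
      intro y hy
      simp only [Set.mem_iUnion]
      refine ⟨fun k => (y k).1, ?_, fun k _ => rfl⟩
      simpa [hW] using hy
    refine (measure_mono hsub).trans ((measure_biUnion_finset_le _ _).trans ?_)
    simp only [collectedLaw, Measure.pi_pi, measure_fst_eq, hρ, Finset.prod_const,
      Finset.card_univ, Fintype.card_fin, Finset.sum_const, nsmul_eq_mul, le_refl]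
  have hreal : (collectedLaw F G ρ t).real
      {y | ∀ j, g ≤ (Finset.univ.filter fun k => (y k).1 = j).card}
      ≤ W.card * ((n : ℝ)⁻¹) ^ t := by
    have := ENNReal.toReal_mono (by
      refine ENNReal.mul_ne_top (by simp) (ENNReal.pow_ne_top ?_)
      simp [hn.ne']) hle
    simpa [Measure.real] using this
  refine hreal.trans ?_
  have hcard := card_occupancy_le hn t fun _ => g
  rw [Finset.prod_const, Finset.card_univ, Fintype.card_fin] at hcard
  calc (W.card : ℝ) * ((n : ℝ)⁻¹) ^ t
      ≤ (n ^ t * (1 - binomialLT (1 / n) t g) ^ n) * ((n : ℝ)⁻¹) ^ t := by gcongr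
    _ = (1 - binomialLT (1 / n) t g) ^ n := by
      rw [inv_pow]
      field_simp

lemma finrank_span_residualVectors_le {F : Type*} [Field F] {n N t : ℕ}
    {G : Fin n → Finset (Fin N)} (y : Fin t → CodedPacket F G) (S : Finset (Fin N)) (j : Fin n) :
    Module.finrank F (Submodule.span F (residualVectors y S j))
      ≤ (Finset.univ.filter fun k => (y k).1 = j).card := by
  classical
  set v : Fin t → (G j → F) := fun k i =>
    if h : (y k).1 = j then (if (i : Fin N) ∈ S then 0 else (h ▸ (y k).2 : G j → F) i) else 0
    with hv
  have hsub : residualVectors y S j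
      ⊆ ((Finset.univ.filter fun k => (y k).1 = j).image v : Finset (G j → F)) := by
    rintro _ ⟨k, e, hk, rfl⟩
    have hk1 : (y k).1 = j := by rw [hk]
    simp only [Finset.coe_image, Set.mem_image, Finset.mem_coe, Finset.mem_filter,
      Finset.mem_univ, true_and]
    refine ⟨k, hk1, ?_⟩
    funext i
    have he : (hk1 ▸ (y k).2 : G j → F) = e := by
      generalize y k = c at hk hk1
      subst hk
      rfl
    simp only [hv, dif_pos hk1, he]
  exact (Submodule.finrank_mono (Submodule.span_mono hsub)).trans
    ((finrank_span_finset_le_card _).trans Finset.card_image_le)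

/-- With disjoint generations, nothing decoded elsewhere removes an unknown of generation `j`, so
that fewer than `#(G j)` packets collected for it leave all of its packets undecoded. -/
lemma not_packetDecoded_of_card_lt {F : Type*} [Field F] {n N t : ℕ}
    {G : Fin n → Finset (Fin N)} (hG : ∀ j k, j ≠ k → Disjoint (G j) (G k))
    (y : Fin t → CodedPacket F G) (j : Fin n)
    (hj : (Finset.univ.filter fun k => (y k).1 = j).card < (G j).card) (i : Fin N)
    (hi : PacketDecoded y i) : i ∉ G j := by
  induction hi with
  | step S _ k hk i hik ih =>
    intro hij
    have hkj : k = j := by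
      by_contra hne
      exact Finset.disjoint_left.1 (hG k j hne) hik hij
    subst hkj
    have hS : G k \ S = G k :=
      Finset.sdiff_eq_self_of_disjoint (Finset.disjoint_right.2 fun i hi => ih i hi)
    have := finrank_span_residualVectors_le y S k
    rw [GenerationDecodable, hS] at hk
    omega

instance collectedLaw.instIsProbabilityMeasure {F : Type*} [Field F] [Fintype F] {n N : ℕ}
    (G : Fin n → Finset (Fin N)) (ρ : PMF (Fin n)) (t : ℕ) :
    IsProbabilityMeasure (collectedLaw F G ρ t) := by
  unfold collectedLaw
  infer_instance

lemma one_sub_exp_le_failureProb {F : Type*} [Field F] [Fintype F] {n N g : ℕ}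
    {G : Fin n → Finset (Fin N)} {ρ : PMF (Fin n)} (hg : 1 ≤ g) (hn : 0 < n)
    (hcard : ∀ j, (G j).card = g) (hG : ∀ j k, j ≠ k → Disjoint (G j) (G k))
    (hρ : ∀ j, ρ j = (n : ENNReal)⁻¹) (t : ℕ) :
    1 - Real.exp (-(n * binomialLT (1 / n) t g)) ≤ failureProb F G ρ t := by
  have hn' : (0 : ℝ) < n := by exact_mod_cast hn
  have h0 : (0 : ℝ) ≤ 1 / n := by positivity
  have h1 : (1 : ℝ) / n ≤ 1 := by
    rw [div_le_one hn']
    exact_mod_cast hn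
  have hcover : (Set.univ : Set (Fin t → CodedPacket F G)) ⊆ {y | DecodingFailure y} ∪
      {y | ∀ j, g ≤ (Finset.univ.filter fun k => (y k).1 = j).card} := by
    intro y _
    by_contra hy
    simp only [Set.mem_union, Set.mem_ofPred_eq, not_or, not_forall, not_le] at hy
    obtain ⟨hdec, j, hj⟩ := hy
    rw [← hcard j] at hj
    obtain ⟨i, hi⟩ : (G j).Nonempty := Finset.card_pos.1 (by rw [hcard j]; exact hg)
    exact hdec ⟨i, fun h => not_packetDecoded_of_card_lt hG y j hj i h hi⟩
  have hu := (measureReal_mono (μ := collectedLaw F G ρ t) hcover).trans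
    (measureReal_union_le _ _)
  have hocc := collectedLaw_real_occupancy_le (F := F) G ρ hn hρ t g
  have hexp : (1 - binomialLT (1 / n) t g) ^ n ≤ Real.exp (-(n * binomialLT (1 / n) t g)) := by
    rw [← mul_neg, Real.exp_nat_mul]
    refine pow_le_pow_left₀ (by linarith [binomialLT_le_one h0 h1 t g]) ?_ n
    linarith [Real.add_one_le_exp (-binomialLT (1 / n) t g)]
  rw [probReal_univ] at hu
  unfold failureProb
  linarith

/-! ### Comparison of the exponents -/

lemma exp_le_one_sub_inv_pow {n : ℕ} (hn : 2 ≤ n) (t : ℕ) :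
    Real.exp (-((t : ℝ) / n)) * Real.exp (-((t : ℝ) / n / (n - 1))) ≤ (1 - 1 / (n : ℝ)) ^ t := by
  have hn' : (2 : ℝ) ≤ n := by exact_mod_cast hn
  have hn1 : (0 : ℝ) < n - 1 := by linarith
  have hbase : Real.exp (-(1 / ((n : ℝ) - 1))) ≤ 1 - 1 / n := by
    rw [Real.exp_neg]
    refine inv_le_of_inv_le₀ (by rw [sub_pos, div_lt_one] <;> linarith) ?_
    refine le_trans (le_of_eq ?_) (Real.add_one_le_exp _)
    field_simp
    ring
  calc Real.exp (-((t : ℝ) / n)) * Real.exp (-((t : ℝ) / n / (n - 1)))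
      = Real.exp (-(1 / ((n : ℝ) - 1))) ^ t := by
        rw [← Real.exp_add, ← Real.exp_nat_mul]
        congr 1
        field_simp
        ring
    _ ≤ _ := pow_le_pow_left₀ (Real.exp_pos _).le hbase t

lemma exp_neg_le_inv {x : ℝ} (hx : 0 < x) : Real.exp (-x) ≤ 1 / x := by
  rw [Real.exp_neg, ← one_div]
  exact one_div_le_one_div_of_le hx (by linarith [Real.add_one_le_exp x])

/-- A relative error `δ` in the exponent costs an absolute error `2 * δ`, uniformly in `x`. -/
lemma exp_neg_one_sub_mul_le {x δ : ℝ} (hx : 0 < x) (h0 : 0 ≤ δ) (h1 : δ ≤ 1 / 2) :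
    Real.exp (-(x * (1 - δ))) ≤ Real.exp (-x) + 2 * δ := by
  have hsplit : Real.exp (-x) = Real.exp (-(x * (1 - δ))) * Real.exp (-(δ * x)) := by
    rw [← Real.exp_add]
    ring_nf
  have h2 : 1 - δ * x ≤ Real.exp (-(δ * x)) := by linarith [Real.add_one_le_exp (-(δ * x))]
  have h3 : Real.exp (-(x * (1 - δ))) ≤ 2 / x := by
    calc Real.exp (-(x * (1 - δ))) ≤ Real.exp (-(x / 2)) := Real.exp_le_exp.2 (by nlinarith)
      _ ≤ 1 / (x / 2) := exp_neg_le_inv (by positivity)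
      _ = 2 / x := by field_simp
  have h4 : Real.exp (-(x * (1 - δ))) * (δ * x) ≤ 2 * δ := by
    calc Real.exp (-(x * (1 - δ))) * (δ * x) ≤ 2 / x * (δ * x) := by gcongr
      _ = 2 * δ := by field_simp
  have h5 := mul_le_mul_of_nonneg_left h2 (Real.exp_pos (-(x * (1 - δ)))).le
  rw [hsplit]
  linarith

/-- If `t / n` is below `log n - log (log n)`, the expected number of empty urns already is of
order `log n`. -/
lemma exp_binomialLT_le_of_small {n : ℕ} (hn : 3 ≤ n) (m t : ℕ)
    (ht : (t : ℝ) / n ≤ Real.log n - Real.log (Real.log n)) (hl : 0 < Real.log (Real.log n)) :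
    Real.exp (-(n * binomialLT (1 / n) t (m + 1))) ≤ Real.exp 1 / Real.log n := by
  have hn' : (3 : ℝ) ≤ n := by exact_mod_cast hn
  have hL : 0 < Real.log n := Real.log_pos (by linarith)
  have hs : (t : ℝ) / n / (n - 1) ≤ 1 := by
    rw [div_le_one (by linarith)]
    linarith [Real.log_le_sub_one_of_pos (show (0 : ℝ) < n by linarith)]
  have h := pow_le_binomialLT (u := 1 / (n : ℝ)) (by positivity)
    (by rw [div_le_one] <;> linarith) t m
  have hlow : Real.log n * Real.exp (-1) ≤ n * binomialLT (1 / n) t (m + 1) := by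
    have hexp : Real.log n ≤ n * Real.exp (-((t : ℝ) / n)) := by
      calc Real.log n = n * Real.exp (-(Real.log n - Real.log (Real.log n))) := by
            rw [neg_sub, Real.exp_sub, Real.exp_log hL, Real.exp_log (by linarith)]
            field_simp
        _ ≤ _ := by gcongr
    calc Real.log n * Real.exp (-1)
        ≤ (n * Real.exp (-((t : ℝ) / n))) * Real.exp (-((t : ℝ) / n / (n - 1))) := by
          gcongr
      _ = n * (Real.exp (-((t : ℝ) / n)) * Real.exp (-((t : ℝ) / n / (n - 1)))) := by ring
      _ ≤ n * binomialLT (1 / n) t (m + 1) := by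
          gcongr
          exact (exp_le_one_sub_inv_pow (by omega) t).trans h
  calc Real.exp (-(n * binomialLT (1 / n) t (m + 1)))
      ≤ Real.exp (-(Real.log n * Real.exp (-1))) := Real.exp_le_exp.2 (by linarith)
    _ ≤ 1 / (Real.log n * Real.exp (-1)) := exp_neg_le_inv (by positivity)
    _ = Real.exp 1 / Real.log n := by
      rw [Real.exp_neg]
      field_simp

/-- Beyond `2 log n`, the exponent in the limit law is negligible. -/
lemma limit_exponent_le_of_large {n : ℕ} (hn : 3 ≤ n) (m : ℕ) {s : ℝ}
    (hs : 2 * Real.log n ≤ s) :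
    1 / (m.factorial : ℝ) * n * Real.log n ^ m * Real.exp (-s) ≤ (m + 1) / Real.log n := by
  have hn' : (3 : ℝ) ≤ n := by exact_mod_cast hn
  have hL : 0 < Real.log n := Real.log_pos (by linarith)
  have hn0 : (0 : ℝ) < n := by linarith
  have hexp : Real.exp (-s) ≤ 1 / (n * n) := by
    calc Real.exp (-s) ≤ Real.exp (-(Real.log n + Real.log n)) :=
          Real.exp_le_exp.2 (by linarith)
      _ = 1 / (n * n) := by rw [Real.exp_neg, Real.exp_add, Real.exp_log hn0, one_div]
  -- `(log n) ^ (m + 1) ≤ (m + 1)! * n`, from the exponential series at `log n`.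
  have hpow := Real.pow_div_factorial_le_exp (Real.log n) hL.le (m + 1)
  rw [Real.exp_log hn0, div_le_iff₀ (by positivity), Nat.factorial_succ, Nat.cast_mul] at hpow
  calc 1 / (m.factorial : ℝ) * n * Real.log n ^ m * Real.exp (-s)
      ≤ 1 / (m.factorial : ℝ) * n * Real.log n ^ m * (1 / (n * n)) := by gcongr
    _ = Real.log n ^ (m + 1) / (m.factorial * n * Real.log n) := by
        rw [pow_succ]
        field_simp
    _ ≤ (n * (((m + 1 : ℕ) : ℝ) * m.factorial)) / (m.factorial * n * Real.log n) := by gcongr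
    _ = (m + 1) / Real.log n := by
        push_cast
        field_simp

/-- In the window `log n - log (log n) ≤ t / n ≤ 2 log n`, the point mass of the binomial law at
`m` is at least the Poisson value, up to a relative error `O(log (log n) / log n)`. The parameter
`κ` serves to absorb constants into multiples of `log (log n)`. -/
lemma limit_exponent_le_of_window {n : ℕ} (hn : 3 ≤ n) (m t : ℕ) {κ : ℝ}
    (hκ : 1 ≤ κ * Real.log (Real.log n)) (hl : 0 < Real.log (Real.log n))
    (hε : (1 + m * κ) * (Real.log (Real.log n) / Real.log n) ≤ 1)
    (hε' : 8 * κ * (Real.log (Real.log n) / Real.log n) ≤ 1)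
    (ht : Real.log n - Real.log (Real.log n) ≤ (t : ℝ) / n) (ht' : (t : ℝ) / n ≤ 2 * Real.log n) :
    1 / (m.factorial : ℝ) * n * Real.log n ^ m * Real.exp (-((t : ℝ) / n)) *
      (1 - (m * (1 + m * κ) + 8 * κ) * (Real.log (Real.log n) / Real.log n))
      ≤ n * binomialLT (1 / n) t (m + 1) := by
  have hn' : (3 : ℝ) ≤ n := by exact_mod_cast hn
  have hn0 : (0 : ℝ) < n := by linarith
  have hL : 0 < Real.log n := Real.log_pos (by linarith)
  set L := Real.log n with hLdef
  set l := Real.log L with hldef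
  set ε := l / L with hεdef
  have hεpos : 0 < ε := by positivity
  have hκ0 : 0 < κ := by
    by_contra h
    nlinarith
  have hlε : l = L * ε := by rw [hεdef]; field_simp
  set η := (1 + m * κ) * ε with hη
  have hη0 : 0 ≤ η := by positivity
  -- `t - m` is still at least `n L (1 - η)`, because `m / n ≤ m ≤ m κ l`.
  have hcount : n * (L * (1 - η)) ≤ t - m := by
    have h1 : n * (L - l) ≤ t := by
      rw [le_div_iff₀ hn0] at ht
      linarith
    have h2 : (m : ℝ) ≤ n * (m * (κ * l)) := by
      have : (m : ℝ) * 1 ≤ m * (κ * l) := by gcongr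
      nlinarith [mul_nonneg (Nat.cast_nonneg (α := ℝ) m) (show 0 ≤ κ * l by positivity)]
    have h3 : n * (L * (1 - η)) = n * (L - l) - n * (m * (κ * l)) := by
      rw [hη, hlε]
      ring
    linarith
  have hη1 : 0 ≤ 1 - η := by linarith
  have hchoose : (n * L) ^ m * (1 - m * η) ≤ m.factorial * t.choose m := by
    have hsub : (t : ℝ) - m ≤ ((t + 1 - m : ℕ) : ℝ) := by
      have : t ≤ (t + 1 - m) + m := by omega
      have : (t : ℝ) ≤ (t + 1 - m : ℕ) + m := by exact_mod_cast this
      linarith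
    -- Bernoulli's inequality.
    have hbern : 1 - m * η ≤ (1 - η) ^ m := by
      have := one_add_mul_le_pow (a := -η) (by linarith) m
      rw [← sub_eq_add_neg] at this
      linarith
    calc (n * L) ^ m * (1 - m * η) ≤ (n * L) ^ m * (1 - η) ^ m := by gcongr
      _ = (n * (L * (1 - η))) ^ m := by rw [← mul_pow, mul_assoc]
      _ ≤ ((t + 1 - m : ℕ) : ℝ) ^ m := by
          gcongr
          exact hcount.trans hsub
      _ ≤ m.factorial * t.choose m := by
          have := Nat.pow_le_choose (α := ℝ) m t
          rwa [div_le_iff₀' (by positivity)] at this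
  -- The factor by which `(1 - 1 / n) ^ t` may fall short of `exp (-t / n)`.
  have hcorr : 1 - 8 * κ * ε ≤ Real.exp (-((t : ℝ) / n / (n - 1))) := by
    -- `L ^ 2 / 2 ≤ exp L = n ≤ 2 * (n - 1)`.
    have hsq : L ^ 2 ≤ 4 * (n - 1) := by
      have := Real.quadratic_le_exp_of_nonneg hL.le
      rw [hLdef, Real.exp_log hn0, ← hLdef] at this
      nlinarith
    have h1 : (t : ℝ) / n / (n - 1) ≤ 8 * κ * ε := by
      rw [div_le_iff₀ (by linarith)]
      refine ht'.trans ?_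
      have h2 : 1 ≤ κ * (L * ε) := hlε ▸ hκ
      have h3 : 2 * L * L ≤ (8 * κ * ε * (n - 1)) * L := by
        have h4 : 0 ≤ (n : ℝ) - 1 := by linarith
        nlinarith [mul_le_mul_of_nonneg_left h2 h4]
      exact le_of_mul_le_mul_right h3 hL
    linarith [Real.add_one_le_exp (-((t : ℝ) / n / (n - 1)))]
  have hmass := choose_mul_pow_le_binomialLT (u := 1 / (n : ℝ)) (by positivity)
    (by rw [div_le_one] <;> linarith) t m
  have hfac : 1 - (m * (1 + m * κ) + 8 * κ) * ε ≤ (1 - m * η) * (1 - 8 * κ * ε) := by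
    have : 0 ≤ (m * η) * (8 * κ * ε) := by positivity
    rw [hη] at this ⊢
    linarith
  have hE := Real.exp_pos (-((t : ℝ) / n))
  calc 1 / (m.factorial : ℝ) * n * L ^ m * Real.exp (-((t : ℝ) / n)) *
        (1 - (m * (1 + m * κ) + 8 * κ) * ε)
      ≤ 1 / (m.factorial : ℝ) * n * L ^ m * Real.exp (-((t : ℝ) / n)) *
        ((1 - m * η) * (1 - 8 * κ * ε)) := by gcongr
    _ = n * (((n * L) ^ m * (1 - m * η)) / m.factorial * (1 / n) ^ m *
        (Real.exp (-((t : ℝ) / n)) * (1 - 8 * κ * ε))) := by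
        rw [mul_pow, one_div_pow]
        field_simp
    _ ≤ n * ((m.factorial * t.choose m) / m.factorial * (1 / n) ^ m *
        (Real.exp (-((t : ℝ) / n)) * Real.exp (-((t : ℝ) / n / (n - 1))))) := by
        have : 0 ≤ 1 - 8 * κ * ε := by linarith
        gcongr
    _ ≤ n * (t.choose m * (1 / n) ^ m * (1 - 1 / n) ^ t) := by
        rw [mul_div_cancel_left₀ _ (by positivity)]
        have := exp_le_one_sub_inv_pow (n := n) (by omega) t
        gcongr
    _ ≤ _ := by gcongr

theorem theorem6 (g : ℕ) (hg : 1 ≤ g) :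
    ∃ C : ℝ, 0 < C ∧
      ∀ (F : Type*) [Field F] [Fintype F] (n N : ℕ) (G : Fin n → Finset (Fin N))
        (ρ : PMF (Fin n)),
        3 ≤ n →
        (∀ j, (G j).card = g) →
        (∀ j k, j ≠ k → Disjoint (G j) (G k)) →
        (∀ i, ∃ j, i ∈ G j) →
        (∀ j, ρ j = (n : ENNReal)⁻¹) →
        ∀ t : ℕ,
          1 - Real.exp (-(1 / ((g - 1).factorial : ℝ) * n * Real.log n ^ (g - 1)
                * Real.exp (-((t : ℝ) / n))))
              - C * (Real.log (Real.log n) / Real.log n)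
            < failureProb F G ρ t := by
  obtain ⟨m, rfl⟩ : ∃ m, g = m + 1 := ⟨g - 1, by omega⟩
  rw [Nat.add_sub_cancel]
  have hlog3 : 1 < Real.log 3 := by
    rw [Real.lt_log_iff_exp_lt (by norm_num)]
    linarith [Real.exp_one_lt_d9]
  set κ := 1 / Real.log (Real.log 3) with hκdef
  have hll3 : 0 < Real.log (Real.log 3) := Real.log_pos hlog3
  have hκ0 : 0 < κ := by positivity
  set D := m * (1 + m * κ) + 8 * κ with hD
  have hD0 : 0 < D := by positivity
  set A := 1 + m * κ with hA
  have hA0 : 0 < A := by positivity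
  set C₀ := 2 * D + A + Real.exp 1 * κ + (m + 1) * κ with hC₀
  have hC₀D : 2 * D ≤ C₀ := by
    have : 0 ≤ A + Real.exp 1 * κ + (m + 1) * κ := by positivity
    linarith
  have hC₀A : A ≤ C₀ := by
    have : 0 ≤ 2 * D + Real.exp 1 * κ + (m + 1) * κ := by positivity
    linarith
  have hC₀e : Real.exp 1 * κ ≤ C₀ := by
    have : 0 ≤ 2 * D + A + (m + 1) * κ := by positivity
    linarith
  have hC₀m : (m + 1) * κ ≤ C₀ := by
    have : 0 ≤ 2 * D + A + Real.exp 1 * κ := by positivity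
    linarith
  refine ⟨C₀ + 1, by linarith, ?_⟩
  intro F _ _ n N G ρ hn hcard hG _ hρ t
  have hn' : (3 : ℝ) ≤ n := by exact_mod_cast hn
  have hlogn : Real.log 3 ≤ Real.log n := Real.log_le_log (by norm_num) hn'
  have hll : Real.log (Real.log 3) ≤ Real.log (Real.log n) :=
    Real.log_le_log (by linarith) hlogn
  have hL : 0 < Real.log n := by linarith
  have hl : 0 < Real.log (Real.log n) := by linarith
  have hκ : 1 ≤ κ * Real.log (Real.log n) := by
    rw [hκdef, one_div, inv_mul_eq_div, one_le_div hll3]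
    exact hll
  have hinv : ∀ b : ℝ, 0 ≤ b →
      b / Real.log n ≤ b * κ * (Real.log (Real.log n) / Real.log n) := by
    intro b hb
    calc b / Real.log n ≤ b * (κ * Real.log (Real.log n)) / Real.log n := by
          gcongr
          nlinarith
      _ = _ := by ring
  have hfail := one_sub_exp_le_failureProb (F := F) hg (by omega) hcard hG hρ t
  set x := 1 / (m.factorial : ℝ) * n * Real.log n ^ m * Real.exp (-((t : ℝ) / n)) with hx
  have hx0 : 0 < x := by positivity
  have hp0 : 0 ≤ n * binomialLT (1 / n) t (m + 1) :=
    mul_nonneg (by linarith) (binomialLT_nonneg (by positivity)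
      (by rw [div_le_one] <;> linarith) t _)
  have hexp1 : Real.exp (-(n * binomialLT (1 / n) t (m + 1))) ≤ 1 :=
    Real.exp_le_one_iff.2 (by linarith)
  have hexpx := Real.exp_pos (-x)
  -- The summand `1` of the constant `C₀ + 1` makes the inequality strict.
  suffices hmain : Real.exp (-(n * binomialLT (1 / n) t (m + 1)))
      ≤ Real.exp (-x) + C₀ * (Real.log (Real.log n) / Real.log n) by
    have : 0 < Real.log (Real.log n) / Real.log n := by positivity
    linarith
  set ε := Real.log (Real.log n) / Real.log n with hε
  have hε0 : 0 < ε := by positivity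
  -- If `ε` is not small, the error term alone exceeds `1`.
  by_cases hbig : 1 ≤ C₀ * ε
  · linarith
  have hbound : ∀ b ≤ C₀, b * ε ≤ C₀ * ε := fun b hb => mul_le_mul_of_nonneg_right hb hε0.le
  rcases le_total ((t : ℝ) / n) (Real.log n - Real.log (Real.log n)) with hs | hs
  · have h1 := exp_binomialLT_le_of_small hn m t hs hl
    linarith [hinv _ (Real.exp_pos 1).le, hbound _ hC₀e]
  rcases le_total (2 * Real.log n) ((t : ℝ) / n) with hs' | hs'
  · have h1 := limit_exponent_le_of_large hn m hs'
    linarith [hinv (m + 1) (by positivity), hbound _ hC₀m, Real.add_one_le_exp (-x)]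
  · have h8 : 8 * κ ≤ C₀ := by
      have : 0 ≤ m * (1 + m * κ) := by positivity
      linarith
    have h1 := limit_exponent_le_of_window hn m t hκ hl (by linarith [hbound _ hC₀A])
      (by linarith [hbound _ h8]) hs hs'
    have h2 := exp_neg_one_sub_mul_le (δ := D * ε) hx0 (by positivity)
      (by linarith [hbound _ hC₀D])
    have h3 : Real.exp (-(n * binomialLT (1 / n) t (m + 1))) ≤ Real.exp (-(x * (1 - D * ε))) :=
      Real.exp_le_exp.2 (by linarith)
    linarith [hbound _ hC₀D]
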